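/- Let $k$ be a field; all algebras are unital and associative, all coalgebras are counital and coassociative, and $\otimes=\otimes_k$. Conventions. Every algebra $A$ carries its cofinite topology: a subspace is open if and only if it contains a two-sided ideal of finite codimension. For linearly topologized spaces $E,F$, let $E\otimes^! F$ be $E\otimes F$ with the linear topology in which a subspace is open if and only if it contains $E_0\otimes F+E\otimes F_0$ for some open subspaces $E_0\subseteq E$, $F_0\subseteq F$. Write $E^\circ$ for the space of continuous linear functionals $E\to k$ ($k$ discrete). For an algebra $A$, $A^\circ$ is the finite dual, i.e. the functionals whose kernel contains a two-sided ideal of finite codimension; it is a coalgebra with comultiplication dual to multiplication ($\Delta(\varphi)=\sum\varphi_1\otimes\varphi_2$ with $\sum\varphi_1(x)\varphi_2(y)=\varphi(xy)$) and counit $\varphi\mapsto\varphi(1)$. For algebras $A,B$ one has $A^\circ\otimes B^\circ\cong(A\otimes^! B)^\circ$, so a continuous linear map $\rho\colon B\otimes^! A\to A\otimes^! B$ has a continuous dual $\rho^\circ\colon A^\circ\otimes B^\circ\to B^\circ\otimes A^\circ$. For coalgebras $C,D$, a linear map $\phi\colon C\otimes D\to D\otimes C$ is a cotwisting map if $\Delta_\phi=(\mathrm{id}_C\otimes\phi\otimes\mathrm{id}_D)\circ(\Delta_C\otimes\Delta_D)$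 is coassociative on $C\otimes D$ with counit $\varepsilon_C\otimes\varepsilon_D$; the resulting coalgebra is denoted $C\#^\phi D$. Let $H$ be a Hopf algebra over $k$ and let $A$ be a left $H$-module algebra. Let $$\rho\colon H\otimes A\to A\otimes H,\qquad \rho(h\otimes a)=\sum (h_{(1)}\cdot a)\otimes h_{(2)},$$ and let $A\# H$ be the smash product, that is, $A\otimes H$ with identity $1\otimes 1$ and multiplication $(a\otimes g)(b\otimes h)=\sum a(g_{(1)}\cdot b)\otimes g_{(2)}h$. Let $A^H=\{a\in A: h\cdot a=\varepsilon(h)a\text{ for all }h\in H\}$. **Theorem.** Suppose that 1. $A$ is finitely generated both as a left and as a right module over $A^H$; 2. the action of $H$ on $A$ factors through a finite-dimensional Hopf algebra: there are a finite-dimensional Hopf algebra $K$ over $k$, a left $K$-module algebra structure on $A$, and a Hopf algebra homomorphism $\pi\colon H\to K$ with $h\cdot a=\pi(h)\cdot a$ for all $h\in H$, $a\in A$. Then $\rho\colon H\otimes^! A\to A\otimes^! H$ is continuous, $\rho^\circ\colon A^\circ\otimes H^\circ\to H^\circ\otimes A^\circ$ is a cotwisting map, and there is an isomorphism of coalgebras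 $$(A\# H)^\circ\;\cong\;A^\circ\,\#^{\rho^\circ} H^\circ .$$ -/

import Mathlib

open scoped TensorProduct Topology
open Coalgebra

noncomputable section

namespace HopfDual

universe u

/-! ### Linear topologies -/

section LinearTopologies

variable {k : Type*} [Field k]

/-- A linear topology on a vector space, given by its family of open subspaces. -/
structure LinearTopology (k : Type*) [Field k] (E : Type*) [AddCommGroup E] [Module k E] where
  opens : Set (Submodule k E)
  top_mem : ⊤ ∈ opens
  inf_mem : ∀ {V W}, V ∈ opens → W ∈ opens → V ⊓ W ∈ opens
  up_mem : ∀ {V W}, V ∈ opens → V ≤ W → W ∈ opens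

variable {E F G : Type*} [AddCommGroup E] [Module k E] [AddCommGroup F] [Module k F]
  [AddCommGroup G] [Module k G]

namespace LinearTopology

/-- The actual topology: a set is open when it contains, around each of its points `x`, a
translate `x + W` of an open subspace `W`. -/
@[reducible] def toTopology (s : LinearTopology k E) : TopologicalSpace E where
  IsOpen U := ∀ x ∈ U, ∃ W ∈ s.opens, ∀ w ∈ W, x + w ∈ U
  isOpen_univ := fun _ _ => ⟨⊤, s.top_mem, fun _ _ => trivial⟩
  isOpen_inter := fun U V hU hV x hx => by
    obtain ⟨W, hW, h⟩ := hU x hx.1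
    obtain ⟨W', hW', h'⟩ := hV x hx.2
    exact ⟨W ⊓ W', s.inf_mem hW hW', fun w hw => ⟨h w hw.1, h' w hw.2⟩⟩
  isOpen_sUnion := fun S hS x hx => by
    obtain ⟨U, hU, hxU⟩ := hx
    obtain ⟨W, hW, h⟩ := hS U hU x hxU
    exact ⟨W, hW, fun w hw => ⟨U, hU, h w hw⟩⟩

/-- The members of `s.opens` are exactly the open subspaces. -/
theorem isOpen_iff_mem_opens (s : LinearTopology k E) (W : Submodule k E) :
    IsOpen[s.toTopology] (W : Set E) ↔ W ∈ s.opens := by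
  constructor
  · intro h
    obtain ⟨V, hV, h'⟩ := h 0 W.zero_mem
    exact s.up_mem hV fun v hv => by simpa using h' v hv
  · intro h x hx
    exact ⟨W, h, fun w hw => W.add_mem hx hw⟩

/-- Continuity of a linear map between linearly topologized vector spaces. -/
def IsContinuous (s : LinearTopology k E) (t : LinearTopology k F) (f : E →ₗ[k] F) : Prop :=
  Continuous[s.toTopology, t.toTopology] f

theorem isContinuous_iff {s : LinearTopology k E} {t : LinearTopology k F} {f : E →ₗ[k] F} :
    s.IsContinuous t f ↔ ∀ W ∈ t.opens, W.comap f ∈ s.opens := by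
  constructor
  · intro h W hW
    rw [← isOpen_iff_mem_opens]
    exact (@continuous_def _ _ s.toTopology t.toTopology f).1 h W
      ((t.isOpen_iff_mem_opens W).2 hW)
  · intro h
    refine (@continuous_def _ _ s.toTopology t.toTopology f).2 fun U hU x hx => ?_
    obtain ⟨W, hW, h'⟩ := hU (f x) hx
    refine ⟨W.comap f, h W hW, fun w hw => ?_⟩
    simpa using h' (f w) hw

/-- The topology is cofinite: every open subspace has finite codimension. -/
def IsCofinite (s : LinearTopology k E) : Prop :=
  ∀ W ∈ s.opens, W.CoFG

/-- The discrete linear topology. -/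
def discrete (k : Type*) [Field k] (E : Type*) [AddCommGroup E] [Module k E] :
    LinearTopology k E where
  opens := Set.univ
  top_mem := trivial
  inf_mem := fun _ _ => trivial
  up_mem := fun _ _ => trivial

theorem discrete_toTopology : (discrete k E).toTopology = ⊥ := by
  refine eq_bot_of_singletons_open (t := (discrete k E).toTopology) fun x y hy => ?_
  exact ⟨⊥, trivial, fun w hw => by rw [(Submodule.mem_bot k).1 hw, add_zero]; exact hy⟩

/-- The subspace `E₀ ⊗ F + E ⊗ F₀` of `E ⊗ F`. -/
def tensorOpen (E₀ : Submodule k E) (F₀ : Submodule k F) : Submodule k (E ⊗[k] F) :=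
  LinearMap.range (TensorProduct.map E₀.subtype (LinearMap.id : F →ₗ[k] F)) ⊔
    LinearMap.range (TensorProduct.map (LinearMap.id : E →ₗ[k] E) F₀.subtype)

theorem tensorOpen_le_iff {E₀ : Submodule k E} {F₀ : Submodule k F}
    {W : Submodule k (E ⊗[k] F)} :
    tensorOpen E₀ F₀ ≤ W ↔
      (∀ x ∈ E₀, ∀ y, x ⊗ₜ[k] y ∈ W) ∧ (∀ x, ∀ y ∈ F₀, x ⊗ₜ[k] y ∈ W) := by
  constructor
  · intro h
    refine ⟨fun x hx y => h (Submodule.mem_sup_left ?_), fun x y hy =>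
      h (Submodule.mem_sup_right ?_)⟩
    · exact ⟨(⟨x, hx⟩ : E₀) ⊗ₜ y, by simp⟩
    · exact ⟨x ⊗ₜ (⟨y, hy⟩ : F₀), by simp⟩
  · rintro ⟨h1, h2⟩
    refine sup_le ?_ ?_
    · rintro _ ⟨z, rfl⟩
      induction z with
      | zero => simp
      | tmul x y => simpa using h1 x x.2 y
      | add a b ha hb => rw [map_add]; exact W.add_mem ha hb
    · rintro _ ⟨z, rfl⟩
      induction z with
      | zero => simp
      | tmul x y => simpa using h2 x y y.2
      | add a b ha hb => rw [map_add]; exact W.add_mem ha hb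

/-- The topological tensor product `E ⊗^! F`: a subspace is open when it contains
`E₀ ⊗ F + E ⊗ F₀` for some open subspaces `E₀` and `F₀`. -/
def tensor (s : LinearTopology k E) (t : LinearTopology k F) : LinearTopology k (E ⊗[k] F) where
  opens := {W | ∃ E₀ ∈ s.opens, ∃ F₀ ∈ t.opens, tensorOpen E₀ F₀ ≤ W}
  top_mem := ⟨⊤, s.top_mem, ⊤, t.top_mem, le_top⟩
  inf_mem := by
    rintro V W ⟨E₀, hE, F₀, hF, h⟩ ⟨E₁, hE', F₁, hF', h'⟩
    rw [tensorOpen_le_iff] at h h'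
    refine ⟨E₀ ⊓ E₁, s.inf_mem hE hE', F₀ ⊓ F₁, t.inf_mem hF hF', ?_⟩
    rw [tensorOpen_le_iff]
    exact ⟨fun x hx y => ⟨h.1 x hx.1 y, h'.1 x hx.2 y⟩,
      fun x y hy => ⟨h.2 x y hy.1, h'.2 x y hy.2⟩⟩
  up_mem := by
    rintro V W ⟨E₀, hE, F₀, hF, h⟩ hVW
    exact ⟨E₀, hE, F₀, hF, h.trans hVW⟩

theorem isContinuous_discrete_iff {s : LinearTopology k E} {φ : Module.Dual k E} :
    s.IsContinuous (discrete k k) φ ↔ LinearMap.ker φ ∈ s.opens := by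
  rw [isContinuous_iff]
  constructor
  · intro h
    exact h ⊥ trivial
  · intro h W _
    exact s.up_mem h fun x hx => by
      rw [Submodule.mem_comap, LinearMap.mem_ker.1 hx]; exact W.zero_mem

/-- The continuous dual `E°` of a linearly topologized vector space, where the field carries the
discrete topology. -/
def continuousDual (s : LinearTopology k E) : Submodule k (Module.Dual k E) where
  carrier := {φ | s.IsContinuous (discrete k k) φ}
  zero_mem' := isContinuous_discrete_iff.2 (s.up_mem s.top_mem fun _ _ => rfl)
  add_mem' := by
    intro φ ψ hφ hψ
    refine isContinuous_discrete_iff.2 (s.up_mem (s.inf_mem (isContinuous_discrete_iff.1 hφ)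
      (isContinuous_discrete_iff.1 hψ)) fun x hx => ?_)
    rw [LinearMap.mem_ker, LinearMap.add_apply, LinearMap.mem_ker.1 hx.1,
      LinearMap.mem_ker.1 hx.2, add_zero]
  smul_mem' := by
    intro c φ hφ
    refine isContinuous_discrete_iff.2 (s.up_mem (isContinuous_discrete_iff.1 hφ) fun x hx => ?_)
    rw [LinearMap.mem_ker, LinearMap.smul_apply, LinearMap.mem_ker.1 hx, smul_zero]

theorem mem_continuousDual_iff {s : LinearTopology k E} {φ : Module.Dual k E} :
    φ ∈ s.continuousDual ↔ LinearMap.ker φ ∈ s.opens :=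
  isContinuous_discrete_iff

/-- The continuous dual `f° : F° → E°` of a continuous linear map `f : E → F`. -/
def dualMap {s : LinearTopology k E} {t : LinearTopology k F} (f : E →ₗ[k] F)
    (hf : s.IsContinuous t f) : t.continuousDual →ₗ[k] s.continuousDual :=
  (f.dualMap.comp t.continuousDual.subtype).codRestrict s.continuousDual fun φ =>
    mem_continuousDual_iff.2
      (isContinuous_iff.1 hf _ (mem_continuousDual_iff.1 φ.2))

@[simp]
theorem dualMap_apply {s : LinearTopology k E} {t : LinearTopology k F} (f : E →ₗ[k] F)
    (hf : s.IsContinuous t f) (φ : t.continuousDual) (x : E) :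
    (dualMap f hf φ).1 x = φ.1 (f x) := rfl

/-- The natural map `E° ⊗ F° → (E ⊗^! F)°`, `(φ ⊗ ψ)(x ⊗ y) = φ(x) ψ(y)`. -/
def dualTensor (s : LinearTopology k E) (t : LinearTopology k F) :
    s.continuousDual ⊗[k] t.continuousDual →ₗ[k] (s.tensor t).continuousDual :=
  ((TensorProduct.dualDistrib k E F).comp
    (TensorProduct.map s.continuousDual.subtype t.continuousDual.subtype)).codRestrict _ <| by
      intro T
      induction T with
      | zero => rw [map_zero]; exact Submodule.zero_mem _
      | add a b ha hb => rw [map_add]; exact Submodule.add_mem _ ha hb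
      | tmul φ ψ =>
        refine mem_continuousDual_iff.2 ⟨_, mem_continuousDual_iff.1 φ.2, _,
          mem_continuousDual_iff.1 ψ.2, tensorOpen_le_iff.2 ⟨fun x hx y => ?_, fun x y hy => ?_⟩⟩
        · simp [LinearMap.mem_ker.1 hx]
        · simp [LinearMap.mem_ker.1 hy]

@[simp]
theorem dualTensor_tmul_apply (s : LinearTopology k E) (t : LinearTopology k F)
    (φ : s.continuousDual) (ψ : t.continuousDual) (x : E) (y : F) :
    (dualTensor s t (φ ⊗ₜ ψ)).1 (x ⊗ₜ y) = φ.1 x * ψ.1 y := rfl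

end LinearTopology

/-- Two jointly injective families of functionals give a jointly injective family on the tensor
product. -/
theorem eq_of_dualDistrib {U V ι κ : Type*} [AddCommMonoid U] [Module k U] [Module.Free k U]
    [AddCommMonoid V] [Module k V] (p : ι → Module.Dual k U) (q : κ → Module.Dual k V)
    (hp : ∀ x x', (∀ i, p i x = p i x') → x = x') (hq : ∀ y y', (∀ j, q j y = q j y') → y = y')
    (T T' : U ⊗[k] V)
    (hT : ∀ i j, TensorProduct.dualDistrib k U V (p i ⊗ₜ q j) T =
      TensorProduct.dualDistrib k U V (p i ⊗ₜ q j) T') : T = T' := by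
  classical
  let b := Module.Free.chooseBasis k U
  apply (TensorProduct.equivFinsuppOfBasisLeft (N := V) b).injective
  have key : ∀ i j, ∀ S : U ⊗[k] V, p i (TensorProduct.rid k U ((q j).lTensor U S)) =
      TensorProduct.dualDistrib k U V (p i ⊗ₜ q j) S := by
    intro i j S
    induction S with
    | zero => simp
    | add a b ha hb => simp only [map_add, ha, hb]
    | tmul x y => simp [mul_comm]
  have key2 : ∀ j, TensorProduct.rid k U ((q j).lTensor U T) =
      TensorProduct.rid k U ((q j).lTensor U T') := fun j =>
    hp _ _ fun i => by rw [key, key, hT]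
  have key3 : ∀ n j, ∀ S : U ⊗[k] V, q j (TensorProduct.lid k V ((b.coord n).rTensor V S)) =
      b.coord n (TensorProduct.rid k U ((q j).lTensor U S)) := by
    intro n j S
    induction S with
    | zero => simp
    | add a b ha hb => simp only [map_add, ha, hb]
    | tmul x y => simp [mul_comm]
  ext n
  rw [TensorProduct.equivFinsuppOfBasisLeft_apply, TensorProduct.equivFinsuppOfBasisLeft_apply]
  exact hq _ _ fun j => by rw [key3, key3, key2]

namespace LinearTopology

instance (s : LinearTopology k E) : Module.Free k s.continuousDual :=
  Module.Free.of_divisionRing k s.continuousDual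

/-- Evaluation at `x`, as a functional on the continuous dual. -/
def eval (s : LinearTopology k E) (x : E) : Module.Dual k s.continuousDual :=
  (Module.Dual.eval k E x).comp s.continuousDual.subtype

@[simp]
theorem eval_apply (s : LinearTopology k E) (x : E) (φ : s.continuousDual) :
    s.eval x φ = φ.1 x := rfl

theorem eq_of_eval (s : LinearTopology k E) (φ ψ : s.continuousDual)
    (h : ∀ x, s.eval x φ = s.eval x ψ) : φ = ψ :=
  Subtype.ext (LinearMap.ext h)

theorem dualTensor_apply_tmul (s : LinearTopology k E) (t : LinearTopology k F)
    (T : s.continuousDual ⊗[k] t.continuousDual) (x : E) (y : F) :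
    (dualTensor s t T).1 (x ⊗ₜ y) =
      TensorProduct.dualDistrib k _ _ (s.eval x ⊗ₜ t.eval y) T := by
  induction T with
  | zero => simp
  | add a b ha hb => simp only [map_add, Submodule.coe_add, LinearMap.add_apply, ha, hb]
  | tmul φ ψ => simp

theorem dualTensor_injective (s : LinearTopology k E) (t : LinearTopology k F) :
    Function.Injective (dualTensor s t) := by
  intro T T' hT
  refine eq_of_dualDistrib s.eval t.eval s.eq_of_eval t.eq_of_eval T T' fun x y => ?_
  rw [← dualTensor_apply_tmul, ← dualTensor_apply_tmul, hT]

theorem dualTensor_surjective (s : LinearTopology k E) (t : LinearTopology k F)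
    (hs : s.IsCofinite) : Function.Surjective (dualTensor s t) := by
  intro φ
  obtain ⟨E₀, hE, F₀, hF, h⟩ := mem_continuousDual_iff.1 φ.2
  rw [tensorOpen_le_iff] at h
  have : Module.Finite k (E ⧸ E₀) := hs E₀ hE
  let b := Module.finBasis k (E ⧸ E₀)
  choose e he using fun i => E₀.mkQ_surjective (b i)
  let β : Fin (Module.finrank k (E ⧸ E₀)) → s.continuousDual := fun i =>
    ⟨(b.coord i).comp E₀.mkQ, mem_continuousDual_iff.2 (s.up_mem hE fun x hx => by
      rw [LinearMap.mem_ker, LinearMap.comp_apply, Submodule.mkQ_apply,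
        (Submodule.Quotient.mk_eq_zero E₀).2 hx, map_zero])⟩
  let ψ : Fin (Module.finrank k (E ⧸ E₀)) → t.continuousDual := fun i =>
    ⟨φ.1.comp (TensorProduct.mk k E F (e i)), mem_continuousDual_iff.2 (t.up_mem hF fun y hy =>
      h.2 (e i) y hy)⟩
  refine ⟨∑ i, β i ⊗ₜ ψ i, Subtype.ext (TensorProduct.ext' fun x y => ?_)⟩
  have hx : x - ∑ i, (β i).1 x • e i ∈ E₀ := by
    rw [← Submodule.Quotient.mk_eq_zero, ← Submodule.mkQ_apply, map_sub, map_sum]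
    simp only [map_smul, he]
    rw [sub_eq_zero]
    exact (b.sum_repr (E₀.mkQ x)).symm
  have h0 : φ.1 ((x - ∑ i, (β i).1 x • e i) ⊗ₜ[k] y) = 0 := h.1 _ hx y
  rw [TensorProduct.sub_tmul, map_sub, sub_eq_zero, TensorProduct.sum_tmul, map_sum] at h0
  rw [h0, dualTensor_apply_tmul, map_sum]
  refine Finset.sum_congr rfl fun i _ => ?_
  simp only [TensorProduct.dualDistrib_apply, eval_apply, ← TensorProduct.smul_tmul', map_smul,
    smul_eq_mul]
  rfl

/-- The natural isomorphism `E° ⊗ F° ≃ (E ⊗^! F)°` for `E` with a cofinite topology. -/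
def dualTensorEquiv (s : LinearTopology k E) (t : LinearTopology k F) (hs : s.IsCofinite) :
    (s.continuousDual ⊗[k] t.continuousDual) ≃ₗ[k] (s.tensor t).continuousDual :=
  LinearEquiv.ofBijective (dualTensor s t)
    ⟨dualTensor_injective s t, dualTensor_surjective s t hs⟩

theorem dualDistrib_dualTensorEquiv_symm (s : LinearTopology k E) (t : LinearTopology k F)
    (hs : s.IsCofinite) (φ : (s.tensor t).continuousDual) (x : E) (y : F) :
    TensorProduct.dualDistrib k _ _ (s.eval x ⊗ₜ t.eval y) ((dualTensorEquiv s t hs).symm φ) =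
      φ.1 (x ⊗ₜ y) := by
  rw [← dualTensor_apply_tmul]
  have : dualTensor s t ((dualTensorEquiv s t hs).symm φ) = φ :=
    (dualTensorEquiv s t hs).apply_symm_apply φ
  rw [this]

end LinearTopology

end LinearTopologies

/-! ### The cofinite topology of an algebra and its finite dual -/

section FiniteDual

open LinearTopology

variable (k : Type*) [Field k] (A : Type*) [Ring A] [Algebra k A]

/-- The cofinite topology on an algebra: a subspace is open when it contains a two-sided ideal of
finite codimension. -/
def cofinite : LinearTopology k A where
  opens := {W | ∃ I : Ideal A, I.IsTwoSided ∧ (I.restrictScalars k).CoFG ∧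
    I.restrictScalars k ≤ W}
  top_mem := ⟨⊤, inferInstance, by
    rw [Submodule.restrictScalars_top]; exact Submodule.CoFG.top, le_top⟩
  inf_mem := by
    rintro V W ⟨I, hI, hI', h⟩ ⟨J, hJ, hJ', h'⟩
    have e : (I ⊓ J).restrictScalars k = I.restrictScalars k ⊓ J.restrictScalars k := rfl
    refine ⟨I ⊓ J, ⟨fun b ha => ⟨hI.mul_mem_of_left b ha.1, hJ.mul_mem_of_left b ha.2⟩⟩, ?_, ?_⟩
    · rw [e]
      exact Submodule.CoFG.inf hI' hJ'
    · rw [e]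
      exact inf_le_inf h h'
  up_mem := by
    rintro V W ⟨I, hI, hI', h⟩ hVW
    exact ⟨I, hI, hI', h.trans hVW⟩

theorem cofinite_isCofinite : (cofinite k A).IsCofinite := by
  rintro W ⟨I, _, hI, h⟩
  exact hI.of_le h

/-- The open two-sided ideals are exactly those of finite codimension. -/
theorem isOpen_ideal_iff (I : Ideal A) [hI : I.IsTwoSided] :
    IsOpen[(cofinite k A).toTopology] (I : Set A) ↔ (I.restrictScalars k).CoFG := by
  have h := (cofinite k A).isOpen_iff_mem_opens (I.restrictScalars k)
  rw [Submodule.coe_restrictScalars] at h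
  rw [h]
  exact ⟨fun h => cofinite_isCofinite k A _ h, fun h => ⟨I, hI, h, le_rfl⟩⟩

/-- The finite dual `A°`, as the continuous dual for the cofinite topology. -/
abbrev finiteDual : Submodule k (Module.Dual k A) := (cofinite k A).continuousDual

/-- `A°` consists of the functionals whose kernel contains an ideal of finite codimension. -/
theorem mem_finiteDual_iff (φ : Module.Dual k A) :
    φ ∈ finiteDual k A ↔ ∃ I : Ideal A, I.IsTwoSided ∧ (I.restrictScalars k).CoFG ∧
      ∀ x ∈ I, φ x = 0 :=
  mem_continuousDual_iff

theorem isContinuous_mul :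
    ((cofinite k A).tensor (cofinite k A)).IsContinuous (cofinite k A) (LinearMap.mul' k A) := by
  rw [isContinuous_iff]
  rintro W ⟨I, hI, hI', h⟩
  have hmem : I.restrictScalars k ∈ (cofinite k A).opens := ⟨I, hI, hI', le_rfl⟩
  refine ⟨_, hmem, _, hmem, tensorOpen_le_iff.2 ⟨fun x hx y => h ?_, fun x y hy => h ?_⟩⟩
  · exact hI.mul_mem_of_left y hx
  · exact I.mul_mem_left x hy

/-- The comultiplication `m° : A° → (A ⊗^! A)° ≃ A° ⊗ A°` of the finite dual. -/
def finiteDualComul : finiteDual k A →ₗ[k] finiteDual k A ⊗[k] finiteDual k A :=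
  (dualTensorEquiv _ _ (cofinite_isCofinite k A)).symm.toLinearMap.comp
    (dualMap (LinearMap.mul' k A) (isContinuous_mul k A))

/-- `Δ(φ) = ∑ φ₁ ⊗ φ₂` is characterized by `∑ φ₁(x) φ₂(y) = φ(x y)`. -/
theorem dualDistrib_finiteDualComul (φ : finiteDual k A) (x y : A) :
    TensorProduct.dualDistrib k _ _ ((cofinite k A).eval x ⊗ₜ (cofinite k A).eval y)
      (finiteDualComul k A φ) = φ.1 (x * y) :=
  dualDistrib_dualTensorEquiv_symm _ _ (cofinite_isCofinite k A) _ x y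

theorem dualDistrib_assoc {U V W : Type*} [AddCommMonoid U] [Module k U] [AddCommMonoid V]
    [Module k V] [AddCommMonoid W] [Module k W] (p : Module.Dual k U) (q : Module.Dual k V)
    (r : Module.Dual k W) (T : (U ⊗[k] V) ⊗[k] W) :
    TensorProduct.dualDistrib k _ _ (p ⊗ₜ TensorProduct.dualDistrib k _ _ (q ⊗ₜ r))
      (TensorProduct.assoc k U V W T) =
    TensorProduct.dualDistrib k _ _ (TensorProduct.dualDistrib k _ _ (p ⊗ₜ q) ⊗ₜ r) T := by
  have : (TensorProduct.dualDistrib k _ _ (p ⊗ₜ TensorProduct.dualDistrib k _ _ (q ⊗ₜ r))).comp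
      (TensorProduct.assoc k U V W).toLinearMap =
      TensorProduct.dualDistrib k _ _ (TensorProduct.dualDistrib k _ _ (p ⊗ₜ q) ⊗ₜ r) := by
    ext; simp [mul_assoc]
  exact LinearMap.congr_fun this T

theorem dualDistrib_rTensor {U U' V : Type*} [AddCommMonoid U] [Module k U] [AddCommMonoid U']
    [Module k U'] [AddCommMonoid V] [Module k V] (p : Module.Dual k U') (q : Module.Dual k V)
    (f : U →ₗ[k] U') (T : U ⊗[k] V) :
    TensorProduct.dualDistrib k _ _ (p ⊗ₜ q) (f.rTensor V T) =
    TensorProduct.dualDistrib k _ _ ((p.comp f : Module.Dual k U) ⊗ₜ q) T := by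
  have : (TensorProduct.dualDistrib k _ _ (p ⊗ₜ q)).comp (f.rTensor V) =
      TensorProduct.dualDistrib k _ _ ((p.comp f : Module.Dual k U) ⊗ₜ q) := by
    ext; simp
  exact LinearMap.congr_fun this T

theorem dualDistrib_lTensor {U V V' : Type*} [AddCommMonoid U] [Module k U] [AddCommMonoid V']
    [Module k V'] [AddCommMonoid V] [Module k V] (p : Module.Dual k U) (q : Module.Dual k V')
    (f : V →ₗ[k] V') (T : U ⊗[k] V) :
    TensorProduct.dualDistrib k _ _ (p ⊗ₜ q) (f.lTensor U T) =
    TensorProduct.dualDistrib k _ _ (p ⊗ₜ (q.comp f : Module.Dual k V)) T := by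
  have : (TensorProduct.dualDistrib k _ _ (p ⊗ₜ q)).comp (f.lTensor U) =
      TensorProduct.dualDistrib k _ _ (p ⊗ₜ (q.comp f : Module.Dual k V)) := by
    ext; simp
  exact LinearMap.congr_fun this T

theorem dualDistrib_comp_finiteDualComul (x y : A) :
    (TensorProduct.dualDistrib k _ _ ((cofinite k A).eval x ⊗ₜ (cofinite k A).eval y)).comp
      (finiteDualComul k A) = (cofinite k A).eval (x * y) :=
  LinearMap.ext fun φ => dualDistrib_finiteDualComul k A φ x y

/-- The finite dual coalgebra: comultiplication dual to the multiplication, counit dual to the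
unit. -/
instance finiteDualCoalgebra : Coalgebra k (finiteDual k A) where
  comul := finiteDualComul k A
  counit := (cofinite k A).eval 1
  coassoc := by
    ext φ : 1
    refine eq_of_dualDistrib (cofinite k A).eval
      (fun p : A × A => TensorProduct.dualDistrib k _ _
        ((cofinite k A).eval p.1 ⊗ₜ (cofinite k A).eval p.2))
      (cofinite k A).eq_of_eval
      (fun T T' hT => eq_of_dualDistrib (cofinite k A).eval (cofinite k A).eval
        (cofinite k A).eq_of_eval (cofinite k A).eq_of_eval T T' fun x y => hT (x, y)) _ _ ?_
    rintro x ⟨y, z⟩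
    simp only [LinearMap.comp_apply, LinearEquiv.coe_coe]
    rw [dualDistrib_assoc, dualDistrib_rTensor, dualDistrib_lTensor,
      dualDistrib_comp_finiteDualComul, dualDistrib_comp_finiteDualComul,
      dualDistrib_finiteDualComul, dualDistrib_finiteDualComul, mul_assoc]
  rTensor_counit_comp_comul := by
    ext φ : 1
    refine eq_of_dualDistrib (fun _ : Unit => (LinearMap.id : k →ₗ[k] k))
      (cofinite k A).eval (fun _ _ h => h ()) (cofinite k A).eq_of_eval _ _ fun i x => ?_
    rw [LinearMap.comp_apply, dualDistrib_rTensor]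
    change TensorProduct.dualDistrib k _ _ ((cofinite k A).eval 1 ⊗ₜ (cofinite k A).eval x)
      (finiteDualComul k A φ) = _
    rw [dualDistrib_finiteDualComul]
    simp
  lTensor_counit_comp_comul := by
    ext φ : 1
    refine eq_of_dualDistrib (cofinite k A).eval
      (fun _ : Unit => (LinearMap.id : k →ₗ[k] k))
      (cofinite k A).eq_of_eval (fun _ _ h => h ()) _ _ fun x i => ?_
    rw [LinearMap.comp_apply, dualDistrib_lTensor]
    change TensorProduct.dualDistrib k _ _ ((cofinite k A).eval x ⊗ₜ (cofinite k A).eval 1)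
      (finiteDualComul k A φ) = _
    rw [dualDistrib_finiteDualComul]
    simp

end FiniteDual

/-! ### Crossed product algebras and coalgebras -/

section Crossed

variable {k : Type*} [Field k]

/-- The map `id ⊗ f ⊗ id : U ⊗ (V ⊗ W) ⊗ Z → U ⊗ (X ⊗ Y) ⊗ Z`, rebracketed. -/
def middle (U Z : Type*) {V W X Y : Type*} [AddCommMonoid U] [Module k U] [AddCommMonoid Z]
    [Module k Z] [AddCommMonoid V] [Module k V] [AddCommMonoid W] [Module k W] [AddCommMonoid X]
    [Module k X] [AddCommMonoid Y] [Module k Y] (f : V ⊗[k] W →ₗ[k] X ⊗[k] Y) :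
    (U ⊗[k] V) ⊗[k] (W ⊗[k] Z) →ₗ[k] (U ⊗[k] X) ⊗[k] (Y ⊗[k] Z) :=
  (TensorProduct.tensorTensorTensorAssoc k U X Y Z).symm.toLinearMap ∘ₗ
    (f.lTensor U).rTensor Z ∘ₗ (TensorProduct.tensorTensorTensorAssoc k U V W Z).toLinearMap

section Algebras

variable {A B : Type*} [Ring A] [Algebra k A] [Ring B] [Algebra k B]

/-- The multiplication `m_ρ = (m_A ⊗ m_B) ∘ (id_A ⊗ ρ ⊗ id_B)` on `A ⊗ B`. -/
def twistedMul (ρ : B ⊗[k] A →ₗ[k] A ⊗[k] B) :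
    (A ⊗[k] B) ⊗[k] (A ⊗[k] B) →ₗ[k] A ⊗[k] B :=
  TensorProduct.map (LinearMap.mul' k A) (LinearMap.mul' k B) ∘ₗ middle A B ρ

/-- `ρ` is a twisting map: `m_ρ` is associative with identity `1 ⊗ 1`. -/
structure IsTwistingMap (ρ : B ⊗[k] A →ₗ[k] A ⊗[k] B) : Prop where
  assoc : ∀ x y z : A ⊗[k] B,
    twistedMul ρ (twistedMul ρ (x ⊗ₜ y) ⊗ₜ z) = twistedMul ρ (x ⊗ₜ twistedMul ρ (y ⊗ₜ z))
  one_mul : ∀ x : A ⊗[k] B, twistedMul ρ ((1 ⊗ₜ 1) ⊗ₜ x) = x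
  mul_one : ∀ x : A ⊗[k] B, twistedMul ρ (x ⊗ₜ (1 ⊗ₜ 1)) = x

/-- The twisted tensor product algebra `A #_ρ B`: the space `A ⊗ B` with multiplication `m_ρ`. -/
def TwistedTensor (ρ : B ⊗[k] A →ₗ[k] A ⊗[k] B) (_hρ : IsTwistingMap ρ) : Type _ := A ⊗[k] B

theorem twistedMul_tmul (ρ : B ⊗[k] A →ₗ[k] A ⊗[k] B) (a c : A) (b d : B) :
    twistedMul ρ ((a ⊗ₜ b) ⊗ₜ (c ⊗ₜ d)) =
      TensorProduct.map (LinearMap.mulLeft k a) (LinearMap.mulRight k d) (ρ (b ⊗ₜ c)) := by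
  have : ∀ S : A ⊗[k] B, TensorProduct.map (LinearMap.mul' k A) (LinearMap.mul' k B)
      ((TensorProduct.tensorTensorTensorAssoc k A A B B).symm ((a ⊗ₜ S) ⊗ₜ d)) =
      TensorProduct.map (LinearMap.mulLeft k a) (LinearMap.mulRight k d) S := by
    intro S
    induction S with
    | zero => simp
    | add x y hx hy => simp only [TensorProduct.add_tmul, TensorProduct.tmul_add, map_add, hx, hy]
    | tmul x y => simp
  exact this _

variable {ρ : B ⊗[k] A →ₗ[k] A ⊗[k] B} (hρ : IsTwistingMap ρ)

instance : AddCommGroup (TwistedTensor ρ hρ) := inferInstanceAs (AddCommGroup (A ⊗[k] B))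

instance : Module k (TwistedTensor ρ hρ) := inferInstanceAs (Module k (A ⊗[k] B))

instance : Ring (TwistedTensor ρ hρ) :=
  { (inferInstance : AddCommGroup (TwistedTensor ρ hρ)) with
    mul := fun x y => twistedMul ρ ((show A ⊗[k] B from x) ⊗ₜ (show A ⊗[k] B from y))
    one := ((1 : A) ⊗ₜ[k] (1 : B) : A ⊗[k] B)
    mul_assoc := hρ.assoc
    one_mul := hρ.one_mul
    mul_one := hρ.mul_one
    left_distrib := fun x y z => by
      change twistedMul ρ ((show A ⊗[k] B from x) ⊗ₜ
        ((show A ⊗[k] B from y) + (show A ⊗[k] B from z))) = _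
      rw [TensorProduct.tmul_add, map_add]; rfl
    right_distrib := fun x y z => by
      change twistedMul ρ (((show A ⊗[k] B from x) + (show A ⊗[k] B from y)) ⊗ₜ
        (show A ⊗[k] B from z)) = _
      rw [TensorProduct.add_tmul, map_add]; rfl
    zero_mul := fun x => by
      change twistedMul ρ ((0 : A ⊗[k] B) ⊗ₜ (show A ⊗[k] B from x)) = _
      rw [TensorProduct.zero_tmul, map_zero]; rfl
    mul_zero := fun x => by
      change twistedMul ρ ((show A ⊗[k] B from x) ⊗ₜ (0 : A ⊗[k] B)) = _
      rw [TensorProduct.tmul_zero, map_zero]; rfl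
    zsmul := fun n x => n • x
    nsmul := fun n x => n • x }

theorem TwistedTensor.mul_def (x y : TwistedTensor ρ hρ) :
    x * y = twistedMul ρ ((show A ⊗[k] B from x) ⊗ₜ (show A ⊗[k] B from y)) := rfl

instance : Algebra k (TwistedTensor ρ hρ) :=
  Algebra.ofModule
    (fun r x y => by
      change twistedMul ρ ((r • (show A ⊗[k] B from x)) ⊗ₜ (show A ⊗[k] B from y)) =
        r • twistedMul ρ _
      rw [← TensorProduct.smul_tmul', map_smul])
    (fun r x y => by
      change twistedMul ρ ((show A ⊗[k] B from x) ⊗ₜ (r • (show A ⊗[k] B from y))) =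
        r • twistedMul ρ _
      rw [TensorProduct.tmul_smul, map_smul])

end Algebras

section Coalgebras

variable {C D : Type*} [AddCommMonoid C] [Module k C] [Coalgebra k C] [AddCommMonoid D] [Module k D]
  [Coalgebra k D]

/-- The comultiplication `Δ_φ = (id_C ⊗ φ ⊗ id_D) ∘ (Δ_C ⊗ Δ_D)` on `C ⊗ D`. -/
def crossedComul (φ : C ⊗[k] D →ₗ[k] D ⊗[k] C) :
    C ⊗[k] D →ₗ[k] (C ⊗[k] D) ⊗[k] (C ⊗[k] D) :=
  middle C D φ ∘ₗ TensorProduct.map comul comul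

/-- The counit `ε_C ⊗ ε_D` on `C ⊗ D`. -/
def crossedCounit (k C D : Type*) [Field k] [AddCommMonoid C] [Module k C] [Coalgebra k C]
    [AddCommMonoid D] [Module k D] [Coalgebra k D] : C ⊗[k] D →ₗ[k] k :=
  TensorProduct.dualDistrib k C D ((counit : C →ₗ[k] k) ⊗ₜ (counit : D →ₗ[k] k))

/-- `φ` is a cotwisting map: `Δ_φ` is coassociative with counit `ε_C ⊗ ε_D`. -/
structure IsCotwistingMap (φ : C ⊗[k] D →ₗ[k] D ⊗[k] C) : Prop where
  coassoc : (TensorProduct.assoc k (C ⊗[k] D) (C ⊗[k] D) (C ⊗[k] D)).toLinearMap ∘ₗ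
    (crossedComul φ).rTensor (C ⊗[k] D) ∘ₗ crossedComul φ =
      (crossedComul φ).lTensor (C ⊗[k] D) ∘ₗ crossedComul φ
  rTensor_counit : (crossedCounit k C D).rTensor (C ⊗[k] D) ∘ₗ crossedComul φ =
    TensorProduct.mk k k (C ⊗[k] D) 1
  lTensor_counit : (crossedCounit k C D).lTensor (C ⊗[k] D) ∘ₗ crossedComul φ =
    (TensorProduct.mk k (C ⊗[k] D) k).flip 1

/-- The crossed product coalgebra `C #^φ D`: the space `C ⊗ D` with comultiplication `Δ_φ` and
counit `ε_C ⊗ ε_D`. -/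
def CrossedCoalgebra (φ : C ⊗[k] D →ₗ[k] D ⊗[k] C) (_hφ : IsCotwistingMap φ) : Type _ :=
  C ⊗[k] D

variable {φ : C ⊗[k] D →ₗ[k] D ⊗[k] C} (hφ : IsCotwistingMap φ)

instance : AddCommMonoid (CrossedCoalgebra φ hφ) := inferInstanceAs (AddCommMonoid (C ⊗[k] D))

instance : Module k (CrossedCoalgebra φ hφ) := inferInstanceAs (Module k (C ⊗[k] D))

instance : Coalgebra k (CrossedCoalgebra φ hφ) where
  comul := crossedComul φ
  counit := crossedCounit k C D
  coassoc := hφ.coassoc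
  rTensor_counit_comp_comul := hφ.rTensor_counit
  lTensor_counit_comp_comul := hφ.lTensor_counit

end Coalgebras

section Dual

open LinearTopology

variable {A B : Type*} [Ring A] [Algebra k A] [Ring B] [Algebra k B]

/-- Continuity of `ρ : B ⊗^! A → A ⊗^! B` for the cofinite topologies on `A` and `B`. -/
def IsContinuousTwist (ρ : B ⊗[k] A →ₗ[k] A ⊗[k] B) : Prop :=
  ((cofinite k B).tensor (cofinite k A)).IsContinuous ((cofinite k A).tensor (cofinite k B)) ρ

/-- The continuous dual `ρ° : A° ⊗ B° ≃ (A ⊗^! B)° → (B ⊗^! A)° ≃ B° ⊗ A°`. -/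
def dualTwist (ρ : B ⊗[k] A →ₗ[k] A ⊗[k] B) (hρ : IsContinuousTwist ρ) :
    finiteDual k A ⊗[k] finiteDual k B →ₗ[k] finiteDual k B ⊗[k] finiteDual k A :=
  (dualTensorEquiv (cofinite k B) (cofinite k A) (cofinite_isCofinite k B)).symm.toLinearMap ∘ₗ
    dualMap ρ hρ ∘ₗ dualTensor (cofinite k A) (cofinite k B)

end Dual

end Crossed

/-! ### Module algebras and smash products -/

section Smash

variable (k : Type*) [Field k]

/-- The map `h ↦ h • a`. -/
def actOn (H : Type*) {A : Type*} [Ring H] [Algebra k H] [Ring A] [Algebra k A] [Module H A]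
    [IsScalarTower k H A] (a : A) : H →ₗ[k] A :=
  (LinearMap.toSpanSingleton H A a).restrictScalars k

@[simp]
theorem actOn_apply {H A : Type*} [Ring H] [Algebra k H] [Ring A] [Algebra k A] [Module H A]
    [IsScalarTower k H A] (a : A) (h : H) : actOn k H a h = h • a := rfl

/-- `A` is a left `H`-module algebra: `h • 1 = ε(h) 1` and
`h • (a b) = ∑ (h₁ • a) (h₂ • b)`. -/
class IsModuleAlgebra (H A : Type*) [Ring H] [Bialgebra k H] [Ring A] [Algebra k A]
    [Module H A] [IsScalarTower k H A] : Prop where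
  smul_one : ∀ h : H, h • (1 : A) = algebraMap k A (counit h)
  smul_mul : ∀ (h : H) (a b : A), h • (a * b) =
    LinearMap.mul' k A (TensorProduct.map (actOn k H a) (actOn k H b) (comul h))

theorem sum_counit_smul_smul (H A : Type*) [Ring H] [Bialgebra k H] [AddCommGroup A] [Module k A]
    (h : H) (c : A)
    (T : H ⊗[k] H →ₗ[k] A)
    (hT : ∀ u v : H, T (u ⊗ₜ v) = ((counit u : k) * (counit v : k)) • c) :
    T (comul h) = (counit h : k) • c := by
  have : T = (LinearMap.toSpanSingleton k A c) ∘ₗ (counit : H →ₗ[k] k) ∘ₗ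
      (TensorProduct.lid k H).toLinearMap ∘ₗ (counit : H →ₗ[k] k).rTensor H := by
    ext u v
    simp [hT]
  rw [this]
  simp

variable (H A : Type*) [Ring H] [Bialgebra k H] [Ring A] [Algebra k A] [Module H A]
  [IsScalarTower k H A]

/-- The subalgebra `A^H` of invariants: `a` with `h • a = ε(h) a` for all `h`. -/
def invariants [IsModuleAlgebra k H A] : Subalgebra k A where
  carrier := {a | ∀ h : H, h • a = (counit h : k) • a}
  algebraMap_mem' := fun r h => by
    rw [Algebra.algebraMap_eq_smul_one, smul_comm, IsModuleAlgebra.smul_one (k := k),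
      Algebra.algebraMap_eq_smul_one, smul_comm]
  add_mem' := fun {a b} ha hb h => by rw [smul_add, smul_add, ha h, hb h]
  mul_mem' := fun {a b} ha hb h => by
    rw [IsModuleAlgebra.smul_mul (k := k)]
    refine sum_counit_smul_smul k H A h (a * b)
      (LinearMap.mul' k A ∘ₗ TensorProduct.map (actOn k H a) (actOn k H b)) fun u v => ?_
    simp [ha u, hb v, smul_smul, mul_comm]

/-- The action `λ : H ⊗ A → A`. -/
def action : H ⊗[k] A →ₗ[k] A := TensorProduct.lift (LinearMap.flip
  { toFun := actOn k H
    map_add' := fun a b => by ext h; simp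
    map_smul' := fun r a => by ext h; exact smul_comm h r a } : H →ₗ[k] A →ₗ[k] A)

/-- The twisting map `ρ : H ⊗ A → A ⊗ H`, `ρ(h ⊗ a) = ∑ (h₁ • a) ⊗ h₂`. -/
def smashTwist : H ⊗[k] A →ₗ[k] A ⊗[k] H :=
  (action k H A).rTensor H ∘ₗ (TensorProduct.assoc k H A H).symm.toLinearMap ∘ₗ
    (TensorProduct.comm k H A).toLinearMap.lTensor H ∘ₗ
      (TensorProduct.assoc k H H A).toLinearMap ∘ₗ (comul : H →ₗ[k] H ⊗[k] H).rTensor A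

theorem smashTwist_tmul (h : H) (a : A) :
    smashTwist k H A (h ⊗ₜ a) = (actOn k H a).rTensor H (comul h) := by
  have : ∀ T : H ⊗[k] H, (action k H A).rTensor H ((TensorProduct.assoc k H A H).symm
      ((TensorProduct.comm k H A).toLinearMap.lTensor H (TensorProduct.assoc k H H A
        (T ⊗ₜ a)))) = (actOn k H a).rTensor H T := by
    intro T
    induction T with
    | zero => simp
    | add x y hx hy => simp only [TensorProduct.add_tmul, map_add, hx, hy]
    | tmul x y => simp [action]
  exact this _

theorem twistedMul_smashTwist (a b : A) (g h : H) :
    twistedMul (smashTwist k H A) ((a ⊗ₜ g) ⊗ₜ (b ⊗ₜ h)) =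
      TensorProduct.map (LinearMap.mulLeft k a ∘ₗ actOn k H b) (LinearMap.mulRight k h)
        (comul g) := by
  rw [twistedMul_tmul, smashTwist_tmul, ← LinearMap.comp_apply, LinearMap.map_comp_rTensor]

theorem smashTwist_assoc [IsModuleAlgebra k H A] (a b c : A) (g l s t : H) :
    (TensorProduct.map (LinearMap.mulLeft k a ∘ₗ actOn k H (b * s • c))
      (LinearMap.mulRight k (t * l))) (comul g) =
    ((LinearMap.mul' k A).rTensor H ∘ₗ (TensorProduct.assoc k A A H).symm.toLinearMap ∘ₗ
      TensorProduct.map (LinearMap.mulLeft k a ∘ₗ actOn k H b)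
        (TensorProduct.map (actOn k H (s • c)) (LinearMap.mulRight k (t * l))))
      (comul.lTensor H (comul g)) := by
  rw [← coassoc_apply]
  generalize (comul g : H ⊗[k] H) = T
  induction T with
  | zero => simp
  | add x y hx hy => simp only [map_add, hx, hy]
  | tmul u w =>
    have h1 : ∀ S : H ⊗[k] H, ((LinearMap.mul' k A).rTensor H ∘ₗ
        (TensorProduct.assoc k A A H).symm.toLinearMap ∘ₗ
        TensorProduct.map (LinearMap.mulLeft k a ∘ₗ actOn k H b)
          (TensorProduct.map (actOn k H (s • c)) (LinearMap.mulRight k (t * l))))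
        (TensorProduct.assoc k H H H (S ⊗ₜ w)) =
        (a * LinearMap.mul' k A (TensorProduct.map (actOn k H b) (actOn k H (s • c)) S)) ⊗ₜ
          (w * (t * l)) := by
      intro S
      induction S with
      | zero => simp
      | add x y hx hy => simp only [TensorProduct.add_tmul, map_add, hx, hy, mul_add]
      | tmul x y => simp [mul_assoc]
    rw [LinearMap.rTensor_tmul, h1, ← IsModuleAlgebra.smul_mul]
    simp [mul_assoc]

/-- The smash product map is a twisting map. -/
theorem isTwistingMap_smashTwist [IsModuleAlgebra k H A] :
    IsTwistingMap (smashTwist k H A) where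
  assoc := by
    intro x y z
    induction x with
    | zero => simp
    | add x x' hx hx' => simp only [TensorProduct.add_tmul, map_add, hx, hx']
    | tmul a g =>
    induction y with
    | zero => simp
    | add y y' hy hy' => simp only [TensorProduct.tmul_add, TensorProduct.add_tmul, map_add, hy, hy']
    | tmul b h =>
    induction z with
    | zero => simp
    | add z z' hz hz' => simp only [TensorProduct.tmul_add, map_add, hz, hz']
    | tmul c l =>
    rw [twistedMul_smashTwist, twistedMul_smashTwist]
    have hL : ∀ T : H ⊗[k] H, twistedMul (smashTwist k H A)
        (TensorProduct.map (LinearMap.mulLeft k a ∘ₗ actOn k H b) (LinearMap.mulRight k h) T ⊗ₜ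
          (c ⊗ₜ l)) =
        ((LinearMap.mul' k A).rTensor H ∘ₗ (TensorProduct.assoc k A A H).symm.toLinearMap ∘ₗ
          TensorProduct.map (LinearMap.mulLeft k a ∘ₗ actOn k H b)
            (TensorProduct.map (actOn k H c) (LinearMap.mulRight k l) ∘ₗ
              LinearMap.mulRight k (comul h))) (comul.lTensor H T) := by
      intro T
      induction T with
      | zero => simp
      | add x y hx hy => simp only [TensorProduct.add_tmul, map_add, hx, hy]
      | tmul u v =>
        rw [TensorProduct.map_tmul, twistedMul_smashTwist]
        simp only [LinearMap.mulRight_apply, Bialgebra.comul_mul, LinearMap.lTensor_tmul,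
          LinearMap.comp_apply, TensorProduct.map_tmul, LinearEquiv.coe_coe]
        generalize (comul v * comul h : H ⊗[k] H) = S
        induction S with
        | zero => simp
        | add x y hx hy => simp only [TensorProduct.tmul_add, map_add, hx, hy]
        | tmul x y => simp [mul_assoc]
    rw [hL]
    generalize (comul h : H ⊗[k] H) = S
    induction S with
    | zero =>
      have : LinearMap.mulRight k (0 : H ⊗[k] H) = 0 := by ext; simp
      simp [this]
    | add x y hx hy =>
      have : LinearMap.mulRight k (x + y) = LinearMap.mulRight k x + LinearMap.mulRight k y := by
        ext; simp [mul_add]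
      simp only [map_add, TensorProduct.tmul_add, this, LinearMap.comp_add, ← hx, ← hy,
        TensorProduct.map_add_right, LinearMap.add_apply, LinearMap.comp_apply] at hx hy ⊢
    | tmul s t =>
      rw [TensorProduct.map_tmul, twistedMul_smashTwist]
      have e : TensorProduct.map (actOn k H c) (LinearMap.mulRight k l) ∘ₗ
          LinearMap.mulRight k (s ⊗ₜ[k] t) =
          TensorProduct.map (actOn k H (s • c)) (LinearMap.mulRight k (t * l)) := by
        ext x y
        simp [mul_smul, mul_assoc]
      rw [e]
      exact (smashTwist_assoc k H A a b c g l s t).symm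
  one_mul := by
    intro x
    induction x with
    | zero => simp
    | add x x' hx hx' => simp only [TensorProduct.tmul_add, map_add, hx, hx']
    | tmul a g =>
      rw [twistedMul_smashTwist, Bialgebra.comul_one, Algebra.TensorProduct.one_def]
      simp
  mul_one := by
    intro x
    induction x with
    | zero => simp
    | add x x' hx hx' => simp only [TensorProduct.add_tmul, map_add, hx, hx']
    | tmul a g =>
      rw [twistedMul_smashTwist]
      have : TensorProduct.map (LinearMap.mulLeft k a ∘ₗ actOn k H (1 : A))
          (LinearMap.mulRight k (1 : H)) =
          TensorProduct.map (LinearMap.toSpanSingleton k A a) LinearMap.id ∘ₗ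
            (counit : H →ₗ[k] k).rTensor H := by
        ext u v
        simp [IsModuleAlgebra.smul_one (k := k), Algebra.algebraMap_eq_smul_one]
      rw [this, LinearMap.comp_apply, rTensor_counit_comul]
      simp

/-- The smash product algebra `A # H`. -/
abbrev SmashProduct [IsModuleAlgebra k H A] : Type _ :=
  TwistedTensor (smashTwist k H A) (isTwistingMap_smashTwist k H A)

end Smash

end HopfDual

end

/-!
Continuity of `ρ` makes the twisted multiplication of `A ⊗^! B` continuous. An open subspace then
contains all products `a x b` with `x` in a suitable open subspace `U`, and as `U` has finite
codimension it contains a two-sided ideal of finite codimension. Conversely, `a ⊗ b` is the product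
of the images of `a` and `b` in `A #_ρ B`, and these two algebra embeddings are continuous, so the
cofinite topology of `A #_ρ B` is that of `A ⊗^! B` and `(A #_ρ B)° ≅ A° ⊗ B°`. The
comultiplication twisted by `ρ°` is a transpose of the twisted multiplication, and a transpose is
unique since the pairings are nondegenerate; hence this isomorphism respects the comultiplications
and carries coassociativity and the counit laws over to `A° ⊗ B°`.

For a smash product, `ρ` is composed of the comultiplication of `H`, which is continuous because it
is an algebra homomorphism, and the action. If the annihilator of `A` has finite codimension in `H`,
then the action is continuous on `H ⊗^! A`: the largest `H`-stable ideal contained in a two-sided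
ideal `I` of finite codimension is an intersection of kernels of finitely many maps `A → A / I`.
-/

namespace HopfDual

noncomputable section

open LinearTopology

section Transpose

variable {k : Type*} [CommSemiring k]
  {E E' F F' G G' U U' V V' : Type*}
  [AddCommMonoid E] [Module k E] [AddCommMonoid E'] [Module k E']
  [AddCommMonoid F] [Module k F] [AddCommMonoid F'] [Module k F']
  [AddCommMonoid G] [Module k G] [AddCommMonoid G'] [Module k G']
  [AddCommMonoid U] [Module k U] [AddCommMonoid U'] [Module k U']
  [AddCommMonoid V] [Module k V] [AddCommMonoid V'] [Module k V']

/-- The pairing `⟨φ ⊗ ψ, x ⊗ y⟩ = ⟨φ, x⟩ ⟨ψ, y⟩` of tensor products induced by two pairings. A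
pairing of `E'` with `E` is encoded as a linear map from `E'` to the dual of `E`. -/
def tensorPairing (p : E' →ₗ[k] Module.Dual k E) (q : F' →ₗ[k] Module.Dual k F) :
    E' ⊗[k] F' →ₗ[k] Module.Dual k (E ⊗[k] F) :=
  TensorProduct.dualDistrib k E F ∘ₗ TensorProduct.map p q

@[simp]
theorem tensorPairing_tmul_tmul (p : E' →ₗ[k] Module.Dual k E) (q : F' →ₗ[k] Module.Dual k F)
    (φ : E') (ψ : F') (x : E) (y : F) :
    tensorPairing p q (φ ⊗ₜ ψ) (x ⊗ₜ y) = p φ x * q ψ y := rfl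

/-- `g : F' → E'` is a transpose of `f : E → F` for pairings of `E'` with `E` and of `F'` with
`F`, that is, `⟨g φ, x⟩ = ⟨φ, f x⟩`. -/
def IsTranspose (p : E' →ₗ[k] Module.Dual k E) (q : F' →ₗ[k] Module.Dual k F)
    (g : F' →ₗ[k] E') (f : E →ₗ[k] F) : Prop :=
  p ∘ₗ g = f.dualMap ∘ₗ q

namespace IsTranspose

variable {p : E' →ₗ[k] Module.Dual k E} {q : F' →ₗ[k] Module.Dual k F}
  {r : G' →ₗ[k] Module.Dual k G} {s : U' →ₗ[k] Module.Dual k U} {t : V' →ₗ[k] Module.Dual k V}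

theorem id : IsTranspose p p LinearMap.id LinearMap.id := rfl

theorem comp {g : F' →ₗ[k] E'} {f : E →ₗ[k] F} {g' : G' →ₗ[k] F'} {f' : F →ₗ[k] G}
    (h : IsTranspose p q g f) (h' : IsTranspose q r g' f') :
    IsTranspose p r (g ∘ₗ g') (f' ∘ₗ f) := by
  rw [IsTranspose, ← LinearMap.comp_assoc, h, LinearMap.comp_assoc, h',
    ← LinearMap.comp_assoc, LinearMap.dualMap_comp_dualMap]

theorem map {g : F' →ₗ[k] E'} {f : E →ₗ[k] F} {g' : V' →ₗ[k] U'} {f' : U →ₗ[k] V}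
    (h : IsTranspose p q g f) (h' : IsTranspose s t g' f') :
    IsTranspose (tensorPairing p s) (tensorPairing q t) (TensorProduct.map g g')
      (TensorProduct.map f f') := by
  refine TensorProduct.ext' fun φ ψ => TensorProduct.ext' fun x y => ?_
  exact congr_arg₂ (· * ·) (DFunLike.congr_fun (LinearMap.congr_fun h φ) x)
    (DFunLike.congr_fun (LinearMap.congr_fun h' ψ) y)

theorem eq_of_injective (hp : Function.Injective p) {f : E →ₗ[k] F} {g g' : F' →ₗ[k] E'}
    (h : IsTranspose p q g f) (h' : IsTranspose p q g' f) : g = g' :=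
  LinearMap.ext fun φ => hp (LinearMap.congr_fun (h.trans h'.symm) φ)

theorem tensorTensorTensorAssoc :
    IsTranspose (tensorPairing (tensorPairing p q) (tensorPairing r s))
      (tensorPairing (tensorPairing p (tensorPairing q r)) s)
      (TensorProduct.tensorTensorTensorAssoc k E' F' G' U').symm.toLinearMap
      (TensorProduct.tensorTensorTensorAssoc k E F G U).toLinearMap := by
  rw [IsTranspose]
  ext
  simp [mul_assoc]

theorem tensorTensorTensorAssoc_symm :
    IsTranspose (tensorPairing (tensorPairing p (tensorPairing q r)) s)
      (tensorPairing (tensorPairing p q) (tensorPairing r s))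
      (TensorProduct.tensorTensorTensorAssoc k E' F' G' U').toLinearMap
      (TensorProduct.tensorTensorTensorAssoc k E F G U).symm.toLinearMap := by
  rw [IsTranspose]
  ext
  simp [mul_assoc]

end IsTranspose

end Transpose

section Transpose

variable {k : Type*} [Field k] {E E' F F' U U' V V' W W' X X' : Type*}
  [AddCommMonoid E] [Module k E] [AddCommMonoid E'] [Module k E']
  [AddCommMonoid F] [Module k F] [AddCommMonoid F'] [Module k F']
  [AddCommMonoid U] [Module k U] [AddCommMonoid U'] [Module k U']
  [AddCommMonoid V] [Module k V] [AddCommMonoid V'] [Module k V']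
  [AddCommMonoid W] [Module k W] [AddCommMonoid W'] [Module k W']
  [AddCommMonoid X] [Module k X] [AddCommMonoid X'] [Module k X']

theorem tensorPairing_injective [Module.Free k E'] {p : E' →ₗ[k] Module.Dual k E}
    {q : F' →ₗ[k] Module.Dual k F} (hp : Function.Injective p) (hq : Function.Injective q) :
    Function.Injective (tensorPairing p q) := by
  intro T T' hT
  have pairing_eq (x : E) (y : F) (S : E' ⊗[k] F') :
      TensorProduct.dualDistrib k _ _ (p.flip x ⊗ₜ q.flip y) S = tensorPairing p q S (x ⊗ₜ y) := by
    induction S with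
    | zero => simp
    | add S S' hS hS' => simp only [map_add, LinearMap.add_apply, hS, hS']
    | tmul φ ψ => rfl
  refine eq_of_dualDistrib p.flip q.flip (fun φ φ' h => hp (LinearMap.ext h))
    (fun ψ ψ' h => hq (LinearMap.ext h)) T T' fun x y => ?_
  rw [pairing_eq, pairing_eq, hT]

theorem IsTranspose.middle {u : U' →ₗ[k] Module.Dual k U} {v : V' →ₗ[k] Module.Dual k V}
    {w : W' →ₗ[k] Module.Dual k W} {x : X' →ₗ[k] Module.Dual k X}
    {p : E' →ₗ[k] Module.Dual k E} {q : F' →ₗ[k] Module.Dual k F}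
    {g : X' ⊗[k] F' →ₗ[k] V' ⊗[k] W'} {f : V ⊗[k] W →ₗ[k] X ⊗[k] F}
    (h : IsTranspose (tensorPairing v w) (tensorPairing x q) g f) :
    IsTranspose (tensorPairing (tensorPairing u v) (tensorPairing w p))
      (tensorPairing (tensorPairing u x) (tensorPairing q p))
      (HopfDual.middle U' E' g) (HopfDual.middle U E f) := by
  have rebracketed := (IsTranspose.id (p := u).map h).map (IsTranspose.id (p := p))
  exact (tensorTensorTensorAssoc.comp rebracketed).comp tensorTensorTensorAssoc_symm

end Transpose

section Continuity

variable {k : Type*} [Field k] {E F G U V W X : Type*}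
  [AddCommGroup E] [Module k E] [AddCommGroup F] [Module k F] [AddCommGroup G] [Module k G]
  [AddCommGroup U] [Module k U] [AddCommGroup V] [Module k V] [AddCommGroup W] [Module k W]
  [AddCommGroup X] [Module k X]

namespace LinearTopology

variable {r : LinearTopology k E} {s : LinearTopology k F} {t : LinearTopology k G}
  {u : LinearTopology k U} {v : LinearTopology k V} {w : LinearTopology k W}
  {x : LinearTopology k X}

theorem isContinuous_id : s.IsContinuous s LinearMap.id :=
  isContinuous_iff.2 fun _ h => h

theorem IsContinuous.comp {g : F →ₗ[k] G} {f : E →ₗ[k] F} (hg : s.IsContinuous t g)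
    (hf : r.IsContinuous s f) : r.IsContinuous t (g ∘ₗ f) :=
  isContinuous_iff.2 fun N hN => isContinuous_iff.1 hf _ (isContinuous_iff.1 hg N hN)

theorem tmul_mem_tensorOpen_left {E₀ : Submodule k E} (F₀ : Submodule k F) {a : E} (ha : a ∈ E₀)
    (b : F) : a ⊗ₜ b ∈ tensorOpen E₀ F₀ :=
  (tensorOpen_le_iff.1 le_rfl).1 a ha b

theorem tmul_mem_tensorOpen_right (E₀ : Submodule k E) {F₀ : Submodule k F} (a : E) {b : F}
    (hb : b ∈ F₀) : a ⊗ₜ b ∈ tensorOpen E₀ F₀ :=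
  (tensorOpen_le_iff.1 le_rfl).2 a b hb

theorem tensorOpen_mem_tensor {E₀ : Submodule k E} {F₀ : Submodule k F} (hE : E₀ ∈ r.opens)
    (hF : F₀ ∈ s.opens) : tensorOpen E₀ F₀ ∈ (r.tensor s).opens :=
  ⟨E₀, hE, F₀, hF, le_rfl⟩

theorem isContinuous_tensor_iff {f : E →ₗ[k] F ⊗[k] G} :
    r.IsContinuous (s.tensor t) f ↔
      ∀ F₀ ∈ s.opens, ∀ G₀ ∈ t.opens, (tensorOpen F₀ G₀).comap f ∈ r.opens := by
  refine isContinuous_iff.trans ⟨fun h F₀ hF G₀ hG => h _ (tensorOpen_mem_tensor hF hG), ?_⟩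
  rintro h N ⟨F₀, hF, G₀, hG, hN⟩
  exact r.up_mem (h F₀ hF G₀ hG) (Submodule.comap_mono hN)

theorem IsContinuous.map {f : E →ₗ[k] F} {g : U →ₗ[k] V} (hf : r.IsContinuous s f)
    (hg : u.IsContinuous v g) :
    (r.tensor u).IsContinuous (s.tensor v) (TensorProduct.map f g) :=
  isContinuous_tensor_iff.2 fun F₀ hF V₀ hV =>
    ⟨_, isContinuous_iff.1 hf F₀ hF, _, isContinuous_iff.1 hg V₀ hV, tensorOpen_le_iff.2
      ⟨fun a ha b => tmul_mem_tensorOpen_left V₀ (a := f a) ha (g b),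
        fun a b hb => tmul_mem_tensorOpen_right F₀ (f a) (b := g b) hb⟩⟩

theorem isContinuous_comm :
    (r.tensor s).IsContinuous (s.tensor r) (TensorProduct.comm k E F).toLinearMap :=
  isContinuous_tensor_iff.2 fun F₀ hF E₀ hE => ⟨E₀, hE, F₀, hF, tensorOpen_le_iff.2
    ⟨fun _ ha _ => tmul_mem_tensorOpen_right _ _ ha,
      fun _ _ hb => tmul_mem_tensorOpen_left _ hb _⟩⟩

theorem isContinuous_assoc : ((r.tensor s).tensor t).IsContinuous (r.tensor (s.tensor t))
    (TensorProduct.assoc k E F G).toLinearMap := by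
  refine isContinuous_tensor_iff.2 ?_
  rintro E₀ hE N ⟨F₀, hF, G₀, hG, hN⟩
  rw [tensorOpen_le_iff] at hN
  refine ⟨_, tensorOpen_mem_tensor hE hF, G₀, hG, tensorOpen_le_iff.2
    ⟨fun S hS c => ?_, fun S c hc => ?_⟩⟩
  · have : tensorOpen E₀ F₀ ≤ (tensorOpen E₀ N).comap ((TensorProduct.assoc k E F G).toLinearMap ∘ₗ
        (TensorProduct.mk k (E ⊗[k] F) G).flip c) :=
      tensorOpen_le_iff.2 ⟨fun _ ha _ => tmul_mem_tensorOpen_left _ ha _,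
        fun _ b hb => tmul_mem_tensorOpen_right _ _ (hN.1 b hb c)⟩
    exact this hS
  · induction S with
    | zero => simp
    | add S S' hS hS' => rw [TensorProduct.add_tmul]; exact Submodule.add_mem _ hS hS'
    | tmul a b => exact tmul_mem_tensorOpen_right _ _ (hN.2 b c hc)

theorem isContinuous_assoc_symm : (r.tensor (s.tensor t)).IsContinuous ((r.tensor s).tensor t)
    (TensorProduct.assoc k E F G).symm.toLinearMap := by
  refine isContinuous_tensor_iff.2 ?_
  rintro N ⟨E₀, hE, F₀, hF, hN⟩ G₀ hG
  rw [tensorOpen_le_iff] at hN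
  refine ⟨E₀, hE, _, tensorOpen_mem_tensor hF hG, tensorOpen_le_iff.2
    ⟨fun a ha S => ?_, fun a S hS => ?_⟩⟩
  · induction S with
    | zero => simp
    | add S S' hS hS' => rw [TensorProduct.tmul_add]; exact Submodule.add_mem _ hS hS'
    | tmul b c => exact tmul_mem_tensorOpen_left _ (hN.1 a ha b) _
  · have : tensorOpen F₀ G₀ ≤ (tensorOpen N G₀).comap
        ((TensorProduct.assoc k E F G).symm.toLinearMap ∘ₗ TensorProduct.mk k E (F ⊗[k] G) a) :=
      tensorOpen_le_iff.2 ⟨fun b hb _ => tmul_mem_tensorOpen_left _ (hN.2 a b hb) _,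
        fun _ _ hc => tmul_mem_tensorOpen_right _ _ hc⟩
    exact this hS

theorem IsContinuous.middle {f : V ⊗[k] W →ₗ[k] X ⊗[k] E}
    (hf : (v.tensor w).IsContinuous (x.tensor r) f) :
    ((u.tensor v).tensor (w.tensor s)).IsContinuous ((u.tensor x).tensor (r.tensor s))
      (HopfDual.middle U F f) :=
  (isContinuous_assoc.comp (isContinuous_assoc_symm.map isContinuous_id)).comp
    (((isContinuous_id.map hf).map isContinuous_id).comp
      ((isContinuous_assoc.map isContinuous_id).comp isContinuous_assoc_symm))

theorem IsCofinite.tensor (hr : r.IsCofinite) (hs : s.IsCofinite) : (r.tensor s).IsCofinite := by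
  rintro N ⟨E₀, hE, F₀, hF, hN⟩
  have : Module.Finite k (E ⧸ E₀) := hr E₀ hE
  have : Module.Finite k (F ⧸ F₀) := hs F₀ hF
  refine (Submodule.CoFG.ker (TensorProduct.map E₀.mkQ F₀.mkQ)).of_le (le_trans ?_ hN)
  rw [TensorProduct.map_ker (LinearMap.exact_subtype_mkQ E₀) E₀.mkQ_surjective
    (LinearMap.exact_subtype_mkQ F₀) F₀.mkQ_surjective, sup_comm]
  exact le_rfl

theorem isTranspose_dualMap {f : E →ₗ[k] F} (hf : r.IsContinuous s f) :
    IsTranspose r.continuousDual.subtype s.continuousDual.subtype (dualMap f hf) f := rfl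

/-- The isomorphism `F° ≃ E°` dual to a linear homeomorphism `E ≃ F`. -/
def dualEquiv (e : E ≃ₗ[k] F) (he : r.IsContinuous s e.toLinearMap)
    (he' : s.IsContinuous r e.symm.toLinearMap) : s.continuousDual ≃ₗ[k] r.continuousDual :=
  LinearEquiv.ofLinearMap (dualMap e.toLinearMap he) (dualMap e.symm.toLinearMap he')
    (by ext; simp) (by ext; simp)

/-- The pairing of `E° ⊗ F°` with `E ⊗ F`. -/
abbrev dualPairing (s : LinearTopology k E) (t : LinearTopology k F) :
    s.continuousDual ⊗[k] t.continuousDual →ₗ[k] Module.Dual k (E ⊗[k] F) :=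
  tensorPairing s.continuousDual.subtype t.continuousDual.subtype

theorem isTranspose_dualTensorEquiv_symm (hs : s.IsCofinite) :
    IsTranspose (dualPairing s t) (s.tensor t).continuousDual.subtype
      (dualTensorEquiv s t hs).symm.toLinearMap LinearMap.id :=
  LinearMap.ext fun φ => congr_arg Subtype.val ((dualTensorEquiv s t hs).apply_symm_apply φ)

end LinearTopology

end Continuity

section CofiniteTopology

variable {k : Type*} [Field k] {R : Type*} [Ring R] [Algebra k R]

/-- The largest two-sided ideal contained in a subspace of an algebra. -/
def idealCore (W : Submodule k R) : Ideal R where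
  carrier := {x | ∀ a b, a * x * b ∈ W}
  zero_mem' := by simp
  add_mem' hx hy a b := by
    rw [mul_add, add_mul]
    exact W.add_mem (hx a b) (hy a b)
  smul_mem' c x hx a b := by
    rw [smul_eq_mul, ← mul_assoc]
    exact hx (a * c) b

instance (W : Submodule k R) : (idealCore W).IsTwoSided where
  mul_mem_of_left c hx a b := by
    rw [← mul_assoc, mul_assoc]
    exact hx a (c * b)

theorem idealCore_le (W : Submodule k R) : (idealCore W).restrictScalars k ≤ W :=
  fun x hx => by simpa using hx 1 1

theorem cofinite_isContinuous_of_map_mul {E : Type*} [AddCommGroup E] [Module k E]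
    {t : LinearTopology k E} (ht : t.IsCofinite) {m : E ⊗[k] E →ₗ[k] E}
    (hm : (t.tensor t).IsContinuous t m) {f : R →ₗ[k] E}
    (hf : ∀ x y, f (x * y) = m (f x ⊗ₜ f y)) : (cofinite k R).IsContinuous t f := by
  refine isContinuous_iff.2 fun W hW => ?_
  obtain ⟨V, hV, _, -, hVW⟩ := isContinuous_iff.1 hm W hW
  obtain ⟨_, -, U, hU, hUV⟩ := isContinuous_iff.1 hm V hV
  rw [tensorOpen_le_iff] at hVW hUV
  have : Module.Finite k (E ⧸ U) := ht U hU
  have ker_le : LinearMap.ker (U.mkQ ∘ₗ f) ≤ (idealCore (W.comap f)).restrictScalars k := by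
    intro x hx a b
    rw [Submodule.mem_comap, hf, hf]
    exact hVW.1 _ (hUV.2 (f a) (f x) (by simpa using hx)) (f b)
  exact ⟨idealCore (W.comap f), inferInstance, (Submodule.CoFG.ker _).of_le ker_le,
    idealCore_le _⟩

theorem cofinite_isContinuous_algHom {S : Type*} [Ring S] [Algebra k S] (f : R →ₐ[k] S) :
    (cofinite k R).IsContinuous (cofinite k S) f.toLinearMap :=
  cofinite_isContinuous_of_map_mul (cofinite_isCofinite k S) (isContinuous_mul k S) (map_mul f)

end CofiniteTopology

section TwistedTensor

variable {k : Type*} [Field k] {A B : Type*} [Ring A] [Algebra k A] [Ring B] [Algebra k B]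
  {ρ : B ⊗[k] A →ₗ[k] A ⊗[k] B}

theorem isContinuous_twistedMul (hρ : IsContinuousTwist ρ) :
    (((cofinite k A).tensor (cofinite k B)).tensor
      ((cofinite k A).tensor (cofinite k B))).IsContinuous
        ((cofinite k A).tensor (cofinite k B)) (twistedMul ρ) :=
  ((isContinuous_mul k A).map (isContinuous_mul k B)).comp hρ.middle

theorem twistedMul_comm_tmul (x y : A ⊗[k] B) :
    twistedMul (TensorProduct.comm k B A).toLinearMap (x ⊗ₜ y) = x * y := by
  suffices twistedMul (TensorProduct.comm k B A).toLinearMap = LinearMap.mul' k (A ⊗[k] B) by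
    simp [this]
  exact TensorProduct.ext_fourfold' fun a b c d => by simp [twistedMul_tmul]

theorem isContinuous_comul (H : Type*) [Ring H] [Bialgebra k H] :
    (cofinite k H).IsContinuous ((cofinite k H).tensor (cofinite k H)) comul :=
  cofinite_isContinuous_of_map_mul ((cofinite_isCofinite k H).tensor (cofinite_isCofinite k H))
    (isContinuous_twistedMul isContinuous_comm)
    fun x y => by rw [twistedMul_comm_tmul, Bialgebra.comul_mul]

namespace IsTwistingMap

theorem apply_one_tmul (hm : IsTwistingMap ρ) (a : A) : ρ (1 ⊗ₜ a) = a ⊗ₜ 1 := by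
  simpa [twistedMul_tmul] using hm.one_mul (a ⊗ₜ 1)

theorem apply_tmul_one (hm : IsTwistingMap ρ) (b : B) : ρ (b ⊗ₜ 1) = 1 ⊗ₜ b := by
  simpa [twistedMul_tmul] using hm.mul_one (1 ⊗ₜ b)

end IsTwistingMap

namespace TwistedTensor

variable (hm : IsTwistingMap ρ)

/-- The identity map from `A ⊗ B` to the underlying space of the algebra `A #_ρ B`. -/
def ofTensor : A ⊗[k] B ≃ₗ[k] TwistedTensor ρ hm :=
  LinearEquiv.refl k (A ⊗[k] B)

theorem ofTensor_mul_ofTensor (x y : A ⊗[k] B) :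
    ofTensor hm x * ofTensor hm y = ofTensor hm (twistedMul ρ (x ⊗ₜ y)) := rfl

/-- The algebra embedding `a ↦ a ⊗ 1` of `A` into `A #_ρ B`. -/
def includeLeft : A →ₐ[k] TwistedTensor ρ hm :=
  AlgHom.ofLinearMap ((ofTensor hm).toLinearMap ∘ₗ (TensorProduct.mk k A B).flip 1) rfl
    fun a a' => by simp [ofTensor_mul_ofTensor, twistedMul_tmul, hm.apply_one_tmul]

/-- The algebra embedding `b ↦ 1 ⊗ b` of `B` into `A #_ρ B`. -/
def includeRight : B →ₐ[k] TwistedTensor ρ hm :=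
  AlgHom.ofLinearMap ((ofTensor hm).toLinearMap ∘ₗ TensorProduct.mk k A B 1) rfl
    fun b b' => by simp [ofTensor_mul_ofTensor, twistedMul_tmul, hm.apply_tmul_one]

theorem includeLeft_mul_includeRight (a : A) (b : B) :
    includeLeft hm a * includeRight hm b = ofTensor hm (a ⊗ₜ b) := by
  refine (ofTensor_mul_ofTensor hm (a ⊗ₜ 1) (1 ⊗ₜ b)).trans ?_
  simp [twistedMul_tmul, hm.apply_one_tmul]

theorem isContinuous_ofTensor :
    ((cofinite k A).tensor (cofinite k B)).IsContinuous (cofinite k (TwistedTensor ρ hm))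
      (ofTensor hm).toLinearMap := by
  have ofTensor_eq : (ofTensor hm).toLinearMap = LinearMap.mul' k (TwistedTensor ρ hm) ∘ₗ
      TensorProduct.map (includeLeft hm).toLinearMap (includeRight hm).toLinearMap :=
    TensorProduct.ext' fun a b => (includeLeft_mul_includeRight hm a b).symm
  rw [ofTensor_eq]
  exact (isContinuous_mul k _).comp
    ((cofinite_isContinuous_algHom (includeLeft hm)).map
      (cofinite_isContinuous_algHom (includeRight hm)))

theorem isContinuous_ofTensor_symm (hρ : IsContinuousTwist ρ) :
    (cofinite k (TwistedTensor ρ hm)).IsContinuous ((cofinite k A).tensor (cofinite k B))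
      (ofTensor hm).symm.toLinearMap :=
  cofinite_isContinuous_of_map_mul ((cofinite_isCofinite k A).tensor (cofinite_isCofinite k B))
    (isContinuous_twistedMul hρ) fun _ _ => rfl

end TwistedTensor

end TwistedTensor

section Duality

variable {k : Type*} [Field k] {A B : Type*} [Ring A] [Algebra k A] [Ring B] [Algebra k B]
  {ρ : B ⊗[k] A →ₗ[k] A ⊗[k] B}

theorem isTranspose_comul_mul' :
    IsTranspose (dualPairing (cofinite k A) (cofinite k A)) (finiteDual k A).subtype
      (comul : finiteDual k A →ₗ[k] _) (LinearMap.mul' k A) :=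
  (isTranspose_dualTensorEquiv_symm (cofinite_isCofinite k A)).comp
    (isTranspose_dualMap (isContinuous_mul k A))

theorem isTranspose_dualTwist (hρ : IsContinuousTwist ρ) :
    IsTranspose (dualPairing (cofinite k B) (cofinite k A))
      (dualPairing (cofinite k A) (cofinite k B)) (dualTwist ρ hρ) ρ :=
  LinearMap.ext fun T => congr_arg Subtype.val
    ((dualTensorEquiv (cofinite k B) (cofinite k A) (cofinite_isCofinite k B)).apply_symm_apply
      (dualMap ρ hρ (dualTensor (cofinite k A) (cofinite k B) T)))

theorem isTranspose_crossedComul_twistedMul (hρ : IsContinuousTwist ρ) :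
    IsTranspose
      (tensorPairing (dualPairing (cofinite k A) (cofinite k B))
        (dualPairing (cofinite k A) (cofinite k B)))
      (dualPairing (cofinite k A) (cofinite k B)) (crossedComul (dualTwist ρ hρ))
      (twistedMul ρ) :=
  (isTranspose_dualTwist hρ).middle.comp (isTranspose_comul_mul'.map isTranspose_comul_mul')

namespace TwistedTensor

variable (hm : IsTwistingMap ρ) (hρ : IsContinuousTwist ρ)

/-- The isomorphism `A° ⊗ B° ≃ (A ⊗^! B)° ≃ (A #_ρ B)°`, whose second factor is dual to the
identity map of `A ⊗ B`. -/
def tensorFiniteDualEquiv :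
    finiteDual k A ⊗[k] finiteDual k B ≃ₗ[k] finiteDual k (TwistedTensor ρ hm) :=
  (dualTensorEquiv (cofinite k A) (cofinite k B) (cofinite_isCofinite k A)).trans
    (dualEquiv (ofTensor hm).symm (isContinuous_ofTensor_symm hm hρ) (isContinuous_ofTensor hm))

theorem isTranspose_tensorFiniteDualEquiv :
    IsTranspose (finiteDual k (TwistedTensor ρ hm)).subtype
      (dualPairing (cofinite k A) (cofinite k B)) (tensorFiniteDualEquiv hm hρ).toLinearMap
      (ofTensor hm).symm.toLinearMap := rfl

theorem map_comp_crossedComul_dualTwist :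
    TensorProduct.map (tensorFiniteDualEquiv hm hρ).toLinearMap
        (tensorFiniteDualEquiv hm hρ).toLinearMap ∘ₗ crossedComul (dualTwist ρ hρ) =
      comul ∘ₗ (tensorFiniteDualEquiv hm hρ).toLinearMap := by
  have transpose_e := isTranspose_tensorFiniteDualEquiv hm hρ
  have transpose_map_comp := (transpose_e.map transpose_e).comp
    (isTranspose_crossedComul_twistedMul hρ)
  have transpose_comul_comp := isTranspose_comul_mul'.comp transpose_e
  have mul_eq : twistedMul ρ ∘ₗ TensorProduct.map (ofTensor hm).symm.toLinearMap
      (ofTensor hm).symm.toLinearMap = (ofTensor hm).symm.toLinearMap ∘ₗ LinearMap.mul' k _ :=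
    TensorProduct.ext' fun _ _ => rfl
  rw [mul_eq] at transpose_map_comp
  exact transpose_map_comp.eq_of_injective
    (tensorPairing_injective (Submodule.subtype_injective _) (Submodule.subtype_injective _))
    transpose_comul_comp

theorem counit_comp_tensorFiniteDualEquiv :
    counit ∘ₗ (tensorFiniteDualEquiv hm hρ).toLinearMap =
      crossedCounit k (finiteDual k A) (finiteDual k B) :=
  TensorProduct.ext' fun _ _ => rfl

end TwistedTensor

section Transport

variable {C D E : Type*} [AddCommMonoid C] [Module k C] [Coalgebra k C] [AddCommMonoid D]
  [Module k D] [Coalgebra k D] [AddCommMonoid E] [Module k E] [Coalgebra k E]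
  {φ : C ⊗[k] D →ₗ[k] D ⊗[k] C}

theorem isCotwistingMap_of_linearEquiv (e : C ⊗[k] D ≃ₗ[k] E)
    (hcomul : TensorProduct.map e.toLinearMap e.toLinearMap ∘ₗ crossedComul φ =
      comul ∘ₗ e.toLinearMap)
    (hcounit : counit ∘ₗ e.toLinearMap = crossedCounit k C D) : IsCotwistingMap φ where
  coassoc := by
    refine (LinearMap.cancel_left (TensorProduct.congr e (TensorProduct.congr e e)).injective).1 ?_
    have map_rTensor : TensorProduct.map (TensorProduct.map e.toLinearMap e.toLinearMap)
        e.toLinearMap ∘ₗ (crossedComul φ).rTensor _ =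
        comul.rTensor E ∘ₗ TensorProduct.map e.toLinearMap e.toLinearMap := by
      rw [LinearMap.map_comp_rTensor, hcomul, LinearMap.rTensor_comp_map]
    have map_lTensor : TensorProduct.map e.toLinearMap (TensorProduct.map e.toLinearMap
        e.toLinearMap) ∘ₗ (crossedComul φ).lTensor _ =
        comul.lTensor E ∘ₗ TensorProduct.map e.toLinearMap e.toLinearMap := by
      rw [LinearMap.map_comp_lTensor, hcomul, LinearMap.lTensor_comp_map]
    calc TensorProduct.map e.toLinearMap (TensorProduct.map e.toLinearMap e.toLinearMap) ∘ₗ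
          (TensorProduct.assoc k _ _ _).toLinearMap ∘ₗ (crossedComul φ).rTensor _ ∘ₗ crossedComul φ
      _ = (TensorProduct.assoc k E E E).toLinearMap ∘ₗ (TensorProduct.map
          (TensorProduct.map e.toLinearMap e.toLinearMap) e.toLinearMap ∘ₗ
            (crossedComul φ).rTensor _) ∘ₗ crossedComul φ := by
        rw [← LinearMap.comp_assoc, TensorProduct.map_map_comp_assoc_eq]
        rfl
      _ = ((TensorProduct.assoc k E E E).toLinearMap ∘ₗ comul.rTensor E ∘ₗ comul) ∘ₗ
          e.toLinearMap := by
        rw [map_rTensor, LinearMap.comp_assoc, hcomul]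
        rfl
      _ = (comul.lTensor E ∘ₗ comul) ∘ₗ e.toLinearMap := by rw [coassoc]
      _ = TensorProduct.map e.toLinearMap (TensorProduct.map e.toLinearMap e.toLinearMap) ∘ₗ
          (crossedComul φ).lTensor _ ∘ₗ crossedComul φ := by
        rw [← LinearMap.comp_assoc, map_lTensor, LinearMap.comp_assoc, LinearMap.comp_assoc, hcomul]
  rTensor_counit := by
    refine (LinearMap.cancel_left (e.lTensor k).injective).1 ?_
    calc e.toLinearMap.lTensor k ∘ₗ (crossedCounit k C D).rTensor _ ∘ₗ crossedComul φ
      _ = (counit : E →ₗ[k] k).rTensor E ∘ₗ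
          TensorProduct.map e.toLinearMap e.toLinearMap ∘ₗ crossedComul φ := by
        rw [← hcounit, ← LinearMap.comp_assoc, LinearMap.lTensor_comp_rTensor,
          ← LinearMap.comp_assoc, LinearMap.rTensor_comp_map]
      _ = TensorProduct.mk k k E 1 ∘ₗ e.toLinearMap := by
        rw [hcomul, ← LinearMap.comp_assoc, rTensor_counit_comp_comul]
      _ = e.toLinearMap.lTensor k ∘ₗ TensorProduct.mk k k _ 1 := rfl
  lTensor_counit := by
    refine (LinearMap.cancel_left (e.rTensor k).injective).1 ?_
    calc e.toLinearMap.rTensor k ∘ₗ (crossedCounit k C D).lTensor _ ∘ₗ crossedComul φ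
      _ = (counit : E →ₗ[k] k).lTensor E ∘ₗ
          TensorProduct.map e.toLinearMap e.toLinearMap ∘ₗ crossedComul φ := by
        rw [← hcounit, ← LinearMap.comp_assoc, LinearMap.rTensor_comp_lTensor,
          ← LinearMap.comp_assoc, LinearMap.lTensor_comp_map]
      _ = (TensorProduct.mk k E k).flip 1 ∘ₗ e.toLinearMap := by
        rw [hcomul, ← LinearMap.comp_assoc, lTensor_counit_comp_comul]
      _ = e.toLinearMap.rTensor k ∘ₗ (TensorProduct.mk k _ k).flip 1 := rfl

end Transport

theorem exists_finiteDual_twistedTensor_coalgEquiv (hm : IsTwistingMap ρ)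
    (hρ : IsContinuousTwist ρ) :
    ∃ hφ : IsCotwistingMap (dualTwist ρ hρ),
      Nonempty (finiteDual k (TwistedTensor ρ hm) ≃ₗc[k]
        CrossedCoalgebra (dualTwist ρ hρ) hφ) := by
  have hcomul := TwistedTensor.map_comp_crossedComul_dualTwist hm hρ
  have hcounit := TwistedTensor.counit_comp_tensorFiniteDualEquiv hm hρ
  have hφ := isCotwistingMap_of_linearEquiv _ hcomul hcounit
  let e : CrossedCoalgebra (dualTwist ρ hρ) hφ ≃ₗc[k] finiteDual k (TwistedTensor ρ hm) :=
    { TwistedTensor.tensorFiniteDualEquiv hm hρ with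
      counit_comp := hcounit
      map_comp_comul := hcomul }
  exact ⟨hφ, ⟨e.symm⟩⟩

end Duality

section Smash

theorem mul'_map_mem {k A V W : Type*} [CommSemiring k] [Semiring A] [Algebra k A]
    [AddCommMonoid V] [Module k V] [AddCommMonoid W] [Module k W]
    {N : Submodule k A} {f : V →ₗ[k] A} {g : W →ₗ[k] A} (h : ∀ v w, f v * g w ∈ N)
    (T : V ⊗[k] W) : LinearMap.mul' k A (TensorProduct.map f g T) ∈ N := by
  induction T with
  | zero => simp
  | add T T' hT hT' => simpa only [map_add] using N.add_mem hT hT'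
  | tmul v w => exact h v w

theorem annihilator_coFG_of_linearMap {k H A V : Type*} [Field k] [Ring H] [Algebra k H]
    [AddCommGroup A] [Module H A] [AddCommGroup V] [Module k V] [FiniteDimensional k V]
    (f : H →ₗ[k] V) (hf : ∀ h, f h = 0 → ∀ a : A, h • a = 0) :
    ((Module.annihilator H A).restrictScalars k).CoFG :=
  (Submodule.CoFG.ker f).of_le fun h hh => Module.mem_annihilator.2 (hf h hh)

variable {k : Type*} [Field k] {H A : Type*} [Ring H] [Bialgebra k H] [Ring A] [Algebra k A]
  [Module H A] [IsScalarTower k H A]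

@[simp]
theorem action_tmul (h : H) (a : A) : action k H A (h ⊗ₜ a) = h • a := rfl

theorem isContinuousTwist_smashTwist
    (hact : ((cofinite k H).tensor (cofinite k A)).IsContinuous (cofinite k A) (action k H A)) :
    IsContinuousTwist (smashTwist k H A) :=
  (hact.map isContinuous_id).comp <| isContinuous_assoc_symm.comp <|
    (isContinuous_id.map isContinuous_comm).comp <| isContinuous_assoc.comp <|
      (isContinuous_comul H).map isContinuous_id

section StableCore

variable [IsModuleAlgebra k H A]

variable (k H) in
/-- The largest `H`-stable left ideal contained in a left ideal of an `H`-module algebra. -/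
def stableCore (I : Ideal A) : Ideal A where
  carrier := {a | ∀ h : H, h • a ∈ I}
  zero_mem' h := by simp
  add_mem' ha hb h := by
    rw [smul_add]
    exact I.add_mem (ha h) (hb h)
  smul_mem' b a ha h := by
    rw [smul_eq_mul, IsModuleAlgebra.smul_mul (k := k)]
    exact mul'_map_mem (N := I.restrictScalars k) (fun g g' => I.mul_mem_left _ (ha g')) _

instance (I : Ideal A) [I.IsTwoSided] : (stableCore k H I).IsTwoSided where
  mul_mem_of_left b ha h := by
    rw [IsModuleAlgebra.smul_mul (k := k)]
    exact mul'_map_mem (N := I.restrictScalars k) (fun g _ => I.mul_mem_right _ (ha g)) _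

theorem stableCore_coFG (hann : ((Module.annihilator H A).restrictScalars k).CoFG) {I : Ideal A}
    (hI : (I.restrictScalars k).CoFG) : ((stableCore k H I).restrictScalars k).CoFG := by
  let actionMod : H →ₗ[k] A →ₗ[k] A ⧸ I.restrictScalars k :=
    TensorProduct.curry ((I.restrictScalars k).mkQ ∘ₗ action k H A)
  have ann_le : (Module.annihilator H A).restrictScalars k ≤ LinearMap.ker actionMod :=
    fun h hh => LinearMap.ext fun a => by
      simp [actionMod, Module.mem_annihilator.1 hh]
  refine (Submodule.CoFG.ker (Submodule.liftQ _ actionMod ann_le).flip).of_le fun a ha h => ?_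
  have := LinearMap.congr_fun ha (Submodule.Quotient.mk h)
  simpa [actionMod] using this

theorem isContinuous_action (hann : ((Module.annihilator H A).restrictScalars k).CoFG) :
    ((cofinite k H).tensor (cofinite k A)).IsContinuous (cofinite k A) (action k H A) := by
  refine isContinuous_iff.2 ?_
  rintro W ⟨I, hI, hI', hIW⟩
  refine ⟨_, ⟨Module.annihilator H A, inferInstance, hann, le_rfl⟩, _,
    ⟨stableCore k H I, inferInstance, stableCore_coFG hann hI', le_rfl⟩, tensorOpen_le_iff.2
      ⟨fun h hh a => hIW ?_, fun h a ha => hIW (ha h)⟩⟩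
  rw [action_tmul, Module.mem_annihilator.1 hh]
  exact zero_mem _

end StableCore

end Smash

end

end HopfDual

open HopfDual in
theorem mainTheorem10_general {k H A : Type*} [Field k] [Ring H] [Bialgebra k H] [Ring A]
    [Algebra k A] [Module H A] [IsScalarTower k H A] [IsModuleAlgebra k H A]
    (hact : ((cofinite k H).tensor (cofinite k A)).IsContinuous (cofinite k A) (action k H A)) :
    ∃ (hρ : IsContinuousTwist (smashTwist k H A))
      (hφ : IsCotwistingMap (dualTwist (smashTwist k H A) hρ)),
      Nonempty (finiteDual k (SmashProduct k H A) ≃ₗc[k]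
        CrossedCoalgebra (dualTwist (smashTwist k H A) hρ) hφ) :=
  ⟨isContinuousTwist_smashTwist hact,
    exists_finiteDual_twistedTensor_coalgEquiv (isTwistingMap_smashTwist k H A) _⟩

open HopfDual in
theorem mainTheorem10 {k H A K : Type*} [Field k] [Ring H] [HopfAlgebra k H]
    [Ring A] [Algebra k A] [Module H A] [IsScalarTower k H A] [IsModuleAlgebra k H A]
    (hleft : Module.Finite (invariants k H A) A)
    (hright : Module.Finite (invariants k H A).op A)
    [Ring K] [HopfAlgebra k K] [FiniteDimensional k K]
    [Module K A] [IsScalarTower k K A] [IsModuleAlgebra k K A]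
    (π : H →ₐc[k] K) (hπ : ∀ (h : H) (a : A), h • a = π h • a) :
    ∃ (hρ : IsContinuousTwist (smashTwist k H A))
      (hφ : IsCotwistingMap (dualTwist (smashTwist k H A) hρ)),
      Nonempty (finiteDual k (SmashProduct k H A) ≃ₗc[k]
        CrossedCoalgebra (dualTwist (smashTwist k H A) hρ) hφ) :=
  mainTheorem10_general <| isContinuous_action <|
    annihilator_coFG_of_linearMap (π : H →ₗ[k] K) fun h hh a => by
      rw [hπ, show π h = 0 from hh, zero_smul]
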